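/- Let $X,Y,Z$ be sets. A (possibly partial) data structure problem $f:X\times Y\rightharpoonup Z$ has \emph{$(s,w,t)$-certificates} if there is a map $T:Y\to(\{0,1\}^w)^s$ (a table of $s$ cells of $w$ bits for each database) such that for every query $x\in X$ and every database $y\in Y$ with $f(x,y)$ defined there is a set $P\subseteq\{1,\dots,s\}$ with $|P|=t$ such that, for every $y'\in Y$ with $T_{y'}(i)=T_y(i)$ for all $i\in P$, either $f(x,y')=f(x,y)$ or $f(x,y')$ is undefined. (If some total extension of $f$ has $(s,w,t)$-certificates, then so does $f$.) For integers $n\ge 1$, $d\ge 0$, $\lambda\ge 0$ and a real $\gamma\ge 1$, the approximate near neighbor problem $\mathrm{ANN}_n^{\lambda,\gamma,d}$ in the Hamming cube has queries $x\in\{0,1\}^d$ and databases $y=(y_1,\dots,y_n)\in(\{0,1\}^d)^n$. Its answer is "yes" if some $y_j$ has Hamming distance at most $\lambda$ from $x$, "no" if every $y_j$ has Hamming distance more than $\gamma\lambda$ from $x$, and it is undefined (any answer is allowed) otherwise. **Theorem.** To every integer $n\ge1$, integer $d\ge0$ and real $\gamma\ge1$ one can assign an integer $\lambda=\lambda(n,d,\gamma)\ge0$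 so that the following hold, with $\log=\log_2$. 1. There is an absolute constant $c>0$ such that, for all integers $n\ge1$, $d\ge 0$ and reals $\gamma\ge1$ with $d\ge(1+5\gamma)\log n$, and all integers $s,w,t\ge0$ with $w\le n$: if $\mathrm{ANN}_n^{\lambda,\gamma,d}$ with $\lambda=\lambda(n,d,\gamma)$ has $(s,w,t)$-certificates, then $$t\;\ge\; c\cdot\frac{d/\gamma^3}{\log\max\{2,\,sw\gamma^3/(nd)\}}$$ (for $d=0$ the right-hand side is read as $0$). 2. In strictly linear space the bound is linear in $d$: for all reals $\gamma\ge1$ and $K>0$ there is a constant $c>0$, depending only on $\gamma$ and $K$, such that for all integers $n\ge1$, $d\ge 0$ with $d\ge(1+5\gamma)\log n$ and all integers $s,w,t\ge0$ with $w\le n$ and $sw\le K\,nd$: if $\mathrm{ANN}_n^{\lambda,\gamma,d}$ with the same $\lambda=\lambda(n,d,\gamma)$ has $(s,w,t)$-certificates, then $t\ge c\,d$. -/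

import Mathlib

/-- A data structure problem with query domain `X`, database domain `Y` and answers in `Z`.
`f x y = some z` says that the answer to query `x` on database `y` is `z`, and `f x y = none` says
that every answer is accepted. A problem `f : X × Y → Z` without a promise is
`fun x y => some (f x y)`. -/
abbrev DSProblem (X Y Z : Type*) := X → Y → Option Z

/-- `f` has `(s, w, t)`-certificates: there is a code `T` storing each database in a table of `s`
cells of `w` bits such that for every query `x` and database `y` there is a set `P` of `t` cells
whose contents determine the answer. Nothing is asked where every answer is accepted, which is the
weakest condition and so makes lower bounds strongest; see `hasCertificates_some_iff` and
`HasCertificates.of_extends`. -/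
def HasCertificates {X Y Z : Type*} (f : DSProblem X Y Z) (s w t : ℕ) : Prop :=
  ∃ T : Y → Fin s → (Fin w → Bool), ∀ (x : X) (y : Y) (z : Z), f x y = some z →
    ∃ P : Finset (Fin s), P.card = t ∧
      ∀ y' : Y, (∀ i ∈ P, T y' i = T y i) → f x y' = some z ∨ f x y' = none

/-- On total problems this is the usual definition of certificates. -/
theorem hasCertificates_some_iff {X Y Z : Type*} (f : X → Y → Z) (s w t : ℕ) :
    HasCertificates (fun x y => some (f x y)) s w t ↔
      ∃ T : Y → Fin s → (Fin w → Bool), ∀ (x : X) (y : Y),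
        ∃ P : Finset (Fin s), P.card = t ∧
          ∀ y' : Y, (∀ i ∈ P, T y' i = T y i) → f x y' = f x y := by
  simp [HasCertificates]

/-- If some way of filling in the free answers of `f` gives a total problem `g` with certificates,
then `f` has them. -/
theorem HasCertificates.of_extends {X Y Z : Type*} {f : DSProblem X Y Z} {g : X → Y → Z}
    {s w t : ℕ} (hfg : ∀ x y z, f x y = some z → g x y = z)
    (hg : HasCertificates (fun x y => some (g x y)) s w t) : HasCertificates f s w t := by
  obtain ⟨T, hT⟩ := (hasCertificates_some_iff g s w t).1 hg
  refine ⟨T, fun x y z hz => ?_⟩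
  obtain ⟨P, hP, h⟩ := hT x y
  refine ⟨P, hP, fun y' hy' => ?_⟩
  rcases hf : f x y' with _ | z'
  · exact Or.inr rfl
  · left
    rw [← hfg x y' z' hf, h y' hy', hfg x y z hz]

open Classical in
/-- The `γ`-approximate near neighbor problem in the Hamming cube `{0,1}^d` with threshold `lam`:
a database consists of `n` points, and the answer to the query point `x` is "yes" if some point of
the database is within distance `lam` of `x`, "no" if all points of the database are at distance
more than `γ * lam` from `x`, and free otherwise. (For `1 ≤ γ` and `0 < n` the first two cases
exclude each other.) -/
noncomputable def ANN (n d lam : ℕ) (γ : ℝ) :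
    DSProblem (Fin d → Bool) (Fin n → (Fin d → Bool)) Bool := fun x y =>
  if ∃ j, hammingDist x (y j) ≤ lam then some true
  else if ∀ j, γ * (lam : ℝ) < (hammingDist x (y j) : ℝ) then some false
  else none

/-!
The threshold is `lam = ⌊d / (20 γ)⌋`, and the bound comes from certificates of "no" answers, by
sampling cells and using isoperimetry in the Hamming cube.

Distances from a fixed query to random points exceed `d / 20 ≥ γ lam` except with exponentially
small probability, and `n ^ 6 ≤ 2 ^ d`, so at least half of all pairs (query, database) have answer
"no" (`card_databases_le_two_mul_card_far`). Sample a set `R` of `m` cells. A certificate of `t`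
cells lies in `R` with probability `ρ = C(m, t) / C(s, t)`, so for a suitable `R` this happens for
a fraction `ρ` of the "no" pairs. Keeping only the databases that occur in many of these pairs, and
among them those with the most frequent contents of the cells in `R`, gives a rectangle `A × B`
without "yes" answers, with `A` of density at least `ρ / 4` and `B` of density at least
`(ρ / 4) / 2 ^ (m w)` (`HasCertificates.exists_rectangle`).

No "yes" answer means that every point of every database in `B` lies in the set `F` of points at
distance at least `lam` from `A`, so the density of `B` is at most the `n`-th power of that of `F`.
But two sets at distance at least `lam` have densities with product at most `exp (-L)`,
`L = lam² / d` (`card_mul_card_le_exp`). If `m w ≤ n L / 2`, comparing these estimates gives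
`ρ ≤ 4 exp (-L / 4)` (`HasCertificates.choose_div_choose_le`).

Taking `m` about `n L / (2 w)` and `ρ ≥ (m / (2 s)) ^ t` this says that
`t log (8 s w / (n L)) ≥ L / 8`, unless already `t ≥ m / 2 ≥ L / 8`. Since `L` is of order
`d / γ²`, this is slightly stronger than the claim.
-/

/-! ### Distant sets in the Hamming cube -/

open Finset in
/-- Two subsets of the cube at Hamming distance at least `D` cannot both be large. Induction on
the dimension: fixing the first coordinate splits each set in two, and two halves that disagree in
that coordinate are only guaranteed distance `D - 1` in the remaining ones. -/
theorem card_mul_card_mul_pow_le {q : ℝ} (hq : 1 ≤ q) (d : ℕ) :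
    ∀ (D : ℕ) (A B : Finset (Fin d → Bool)), (∀ x ∈ A, ∀ y ∈ B, D ≤ hammingDist x y) →
      (#A : ℝ) * #B * q ^ D ≤ (2 + q + q⁻¹) ^ d := by
  have hq0 : 0 < q := by linarith
  have hS : 4 ≤ 2 + q + q⁻¹ := by
    have h : q + q⁻¹ - 2 = (q - 1) ^ 2 / q := by field_simp; ring
    have h' : 0 ≤ (q - 1) ^ 2 / q := by positivity
    linarith
  induction d with
  | zero =>
    intro D A B h
    have hA : #A ≤ 1 := Finset.card_le_one_of_subsingleton A
    have hB : #B ≤ 1 := Finset.card_le_one_of_subsingleton B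
    rcases A.eq_empty_or_nonempty with rfl | ⟨x, hx⟩
    · simp
    rcases B.eq_empty_or_nonempty with rfl | ⟨y, hy⟩
    · simp
    have hD : D = 0 := by simpa [hammingDist] using h x hx y hy
    subst hD
    have : (#A * #B : ℕ) ≤ 1 * 1 := Nat.mul_le_mul hA hB
    simpa using (by exact_mod_cast this : (#A : ℝ) * #B ≤ 1)
  | succ d ih =>
    intro D A B h
    rcases D with _ | D
    · have hc : ∀ C : Finset (Fin (d + 1) → Bool), (#C : ℝ) ≤ 2 ^ (d + 1) := fun C => by
        have := Finset.card_le_univ C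
        simp only [Fintype.card_pi, Fintype.card_bool, prod_const, card_univ, Fintype.card_fin]
          at this
        exact_mod_cast this
      calc (#A : ℝ) * #B * q ^ 0 ≤ 2 ^ (d + 1) * 2 ^ (d + 1) := by
            rw [pow_zero, mul_one]
            exact mul_le_mul (hc A) (hc B) (by positivity) (by positivity)
        _ = 4 ^ (d + 1) := by rw [← mul_pow]; norm_num
        _ ≤ _ := pow_le_pow_left₀ (by norm_num) hS _
    let sl : Finset (Fin (d + 1) → Bool) → Bool → Finset (Fin d → Bool) :=
      fun C b => univ.filter fun x => (Fin.cons b x : Fin (d + 1) → Bool) ∈ C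
    have hsl : ∀ C, (#C : ℝ) = #(sl C false) + #(sl C true) := fun C => by
      have hC : #C = #(sl C false) + #(sl C true) := by
        have : #C = ∑ x : Fin (d + 1) → Bool, if x ∈ C then 1 else 0 := by simp
        rw [this, ← (Fin.consEquiv fun _ => Bool).sum_comp, Fintype.sum_prod_type]
        simp only [sl, Fin.consEquiv, Equiv.coe_fn_mk, Fintype.sum_bool, card_filter]
        exact add_comm _ _
      exact_mod_cast hC
    have hdist : ∀ (a b : Bool) (x y : Fin d → Bool),
        hammingDist (Fin.cons a x : Fin (d + 1) → Bool) (Fin.cons b y) =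
          (if a = b then 0 else 1) + hammingDist x y := fun a b x y => by
      simp [hammingDist, Finset.card_filter, Fin.sum_univ_succ]
    have hsame : ∀ b, (#(sl A b) : ℝ) * #(sl B b) * q ^ (D + 1) ≤ (2 + q + q⁻¹) ^ d :=
      fun b => ih _ _ _ fun x hx y hy => by
        have := h _ (mem_filter.1 hx).2 _ (mem_filter.1 hy).2
        simpa [hdist] using this
    have hdiff : ∀ a b, a ≠ b → (#(sl A a) : ℝ) * #(sl B b) * q ^ D ≤ (2 + q + q⁻¹) ^ d :=
      fun a b hab => ih _ _ _ fun x hx y hy => by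
        have := h _ (mem_filter.1 hx).2 _ (mem_filter.1 hy).2
        rw [hdist, if_neg hab] at this
        omega
    have h00 := hsame false
    have h11 := hsame true
    have h01 := hdiff false true (by decide)
    have h10 := hdiff true false (by decide)
    rw [hsl A, hsl B]
    generalize hN : (2 + q + q⁻¹) ^ d = N at *
    have hN0 : 0 < N := by rw [← hN]; positivity
    have ha0 : (0 : ℝ) ≤ #(sl A false) := by positivity
    have ha1 : (0 : ℝ) ≤ #(sl A true) := by positivity
    have hb0 : (0 : ℝ) ≤ #(sl B false) := by positivity
    have hb1 : (0 : ℝ) ≤ #(sl B true) := by positivity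
    generalize (#(sl A false) : ℝ) = a0 at *
    generalize (#(sl A true) : ℝ) = a1 at *
    generalize (#(sl B false) : ℝ) = b0 at *
    generalize (#(sl B true) : ℝ) = b1 at *
    have hQ : 0 < q ^ D := by positivity
    rw [pow_succ] at h00 h11 ⊢
    rw [pow_succ, hN]
    generalize q ^ D = Q at *
    -- The four products are not independent: the two mixed ones have the same product as the
    -- two pure ones, so they cannot both attain their bound `N`.
    have hprod : (a0 * b1 * Q) * (a1 * b0 * Q) * q ^ 2 ≤ N ^ 2 := by
      calc _ = (a0 * b0 * (Q * q)) * (a1 * b1 * (Q * q)) := by ring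
        _ ≤ N * N := mul_le_mul h00 h11 (by positivity) hN0.le
        _ = N ^ 2 := by ring
    have hmix : q * (a0 * b1 * Q + a1 * b0 * Q) ≤ N * (q + q⁻¹) := by
      have h1 : N * (a0 * b1 * Q + a1 * b0 * Q) ≤ N ^ 2 + N ^ 2 / q ^ 2 := by
        have h2 : (a0 * b1 * Q) * (a1 * b0 * Q) ≤ N ^ 2 / q ^ 2 := by
          rwa [le_div_iff₀ (by positivity)]
        nlinarith [mul_nonneg (sub_nonneg.2 h01) (sub_nonneg.2 h10)]
      have h3 : N ^ 2 + N ^ 2 / q ^ 2 = N * (N * (q + q⁻¹) / q) := by field_simp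
      rw [h3] at h1
      have h4 := le_of_mul_le_mul_left h1 hN0
      rw [le_div_iff₀ hq0] at h4
      linarith
    nlinarith

open Finset in
/-- Optimizing `card_mul_card_mul_pow_le` over `q = exp θ`: the densities of two sets at distance
at least `D` have product at most `exp (-D² / d)`. -/
theorem card_mul_card_le_exp {d D : ℕ} (hd : 0 < d) {A B : Finset (Fin d → Bool)}
    (h : ∀ x ∈ A, ∀ y ∈ B, D ≤ hammingDist x y) :
    (#A : ℝ) * #B ≤ 4 ^ d * Real.exp (-((D : ℝ) ^ 2 / d)) := by
  have hd' : (0 : ℝ) < d := by exact_mod_cast hd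
  -- This choice of `θ` minimizes the exponent `d * θ ^ 2 / 4 - D * θ` reached below.
  set θ : ℝ := 2 * D / d with hθ
  have hθ0 : 0 ≤ θ := by positivity
  have h1 := card_mul_card_mul_pow_le (Real.one_le_exp hθ0) d D A B h
  have h2 : 2 + Real.exp θ + (Real.exp θ)⁻¹ = 4 * Real.cosh (θ / 2) ^ 2 := by
    have h3 : Real.exp θ = Real.exp (θ / 2) ^ 2 := by rw [← Real.exp_nat_mul]; ring_nf
    rw [Real.cosh_eq, Real.exp_neg, h3]
    field_simp
    ring
  have h4 : Real.cosh (θ / 2) ^ 2 ≤ Real.exp (θ ^ 2 / 4) := by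
    calc _ ≤ Real.exp ((θ / 2) ^ 2 / 2) ^ 2 :=
          pow_le_pow_left₀ (Real.cosh_pos _).le (Real.cosh_le_exp_half_sq _) 2
      _ = _ := by rw [← Real.exp_nat_mul]; ring_nf
  have h5 : (2 + Real.exp θ + (Real.exp θ)⁻¹) ^ d ≤ 4 ^ d * Real.exp (d * (θ ^ 2 / 4)) := by
    rw [h2, mul_pow, Real.exp_nat_mul]
    exact mul_le_mul_of_nonneg_left (pow_le_pow_left₀ (by positivity) h4 d) (by positivity)
  have h6 : (#A : ℝ) * #B * Real.exp (D * θ) ≤ 4 ^ d * Real.exp (d * (θ ^ 2 / 4)) := by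
    rw [Real.exp_nat_mul]; exact h1.trans h5
  rw [← le_div_iff₀ (Real.exp_pos _), mul_div_assoc, ← Real.exp_sub] at h6
  have h7 : d * (θ ^ 2 / 4) - D * θ = -((D : ℝ) ^ 2 / d) := by
    rw [hθ]
    field_simp
    ring
  rwa [h7] at h6

/-! ### Random databases have no near neighbor -/

open Finset in
/-- A Hamming ball of radius `d / 20` has density at most `1 / (2 n)`. The ball around `x` is
antipodal to a set far from the single point `x`, so its size is bounded by
`card_mul_card_mul_pow_le`. -/
theorem two_mul_card_ball_le {n d : ℕ} (hd : 3 ≤ d) (hn : n ^ 6 ≤ 2 ^ d) (x : Fin d → Bool) :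
    2 * n * #{z | 20 * hammingDist x z ≤ d} ≤ 2 ^ d := by
  set S : Finset (Fin d → Bool) := {z | 20 * hammingDist x z ≤ d} with hS
  have hanti : ∀ z : Fin d → Bool, hammingDist x (fun i => !z i) + hammingDist x z = d := by
    intro z
    have h := Finset.card_filter_add_card_filter_not (s := (univ : Finset (Fin d)))
      (fun i => x i ≠ z i)
    rw [card_univ, Fintype.card_fin] at h
    have hflip : ∀ i, x i ≠ !z i ↔ ¬ x i ≠ z i := fun i => by
      cases x i <;> cases z i <;> decide
    simp only [hammingDist, hflip]
    rw [add_comm]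
    exact h
  have hinj : Function.Injective fun (z : Fin d → Bool) (i : Fin d) => !z i := fun z z' h => by
    funext i
    simpa using congrFun h i
  have h1 := card_mul_card_mul_pow_le (q := 32) (by norm_num) d (d - d / 20) {x}
    (S.image fun z i => !z i) (by
      intro x' hx' y hy
      obtain ⟨z, hz, rfl⟩ := mem_image.1 hy
      rw [mem_singleton.1 hx']
      have := hanti z
      have hz' := (mem_filter.1 hz).2
      omega)
  rw [card_singleton, card_image_of_injective _ hinj, Nat.cast_one, one_mul] at h1
  have h2 : (#S : ℝ) ≤ (33 / 32) ^ (2 * d) * 32 ^ (d / 20) := by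
    have h3 : (32 : ℝ) ^ (d - d / 20) * 32 ^ (d / 20) = 32 ^ d := by
      rw [← pow_add]; congr 1; omega
    have h4 : (#S : ℝ) * 32 ^ d ≤ (33 / 32) ^ (2 * d) * 32 ^ (d / 20) * 32 ^ d := by
      calc (#S : ℝ) * 32 ^ d = #S * 32 ^ (d - d / 20) * 32 ^ (d / 20) := by
            rw [← h3]; ring
        _ ≤ (2 + 32 + 32⁻¹) ^ d * 32 ^ (d / 20) := by gcongr
        _ = ((33 / 32) ^ 2 * 32) ^ d * 32 ^ (d / 20) := by norm_num
        _ = _ := by rw [mul_pow, ← pow_mul]; ring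
    exact le_of_mul_le_mul_right h4 (by positivity)
  -- The exponents `1/6`, `1/20` and `log 33/32` are cleared by taking the 60th power.
  have h5 : (2 * n * #S : ℝ) ^ 60 ≤ (2 ^ d) ^ 60 := by
    have hn' : (n : ℝ) ^ 60 ≤ 2 ^ (10 * d) := by
      have : (n : ℝ) ^ 6 ≤ 2 ^ d := by exact_mod_cast hn
      calc (n : ℝ) ^ 60 = (n ^ 6) ^ 10 := by ring
        _ ≤ (2 ^ d) ^ 10 := by gcongr
        _ = _ := by rw [← pow_mul, mul_comm]
    have hS' : (#S : ℝ) ^ 60 ≤ 2 ^ (6 * d) * 2 ^ (15 * d) := by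
      calc (#S : ℝ) ^ 60 ≤ ((33 / 32) ^ (2 * d) * 32 ^ (d / 20)) ^ 60 := by gcongr
        _ = ((33 / 32) ^ 120) ^ d * 2 ^ (300 * (d / 20)) := by
          rw [mul_pow, ← pow_mul, ← pow_mul, ← pow_mul, show (32 : ℝ) = 2 ^ 5 by norm_num,
            ← pow_mul]
          congr 2 <;> ring
        _ ≤ (2 ^ 6) ^ d * 2 ^ (15 * d) := by
          refine mul_le_mul (pow_le_pow_left₀ (by positivity) (by norm_num) d)
            (pow_le_pow_right₀ (by norm_num) (by omega)) (by positivity) (by positivity)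
        _ = _ := by rw [← pow_mul]
    calc (2 * n * #S : ℝ) ^ 60 = 2 ^ 60 * n ^ 60 * #S ^ 60 := by ring
      _ ≤ 2 ^ 60 * 2 ^ (10 * d) * (2 ^ (6 * d) * 2 ^ (15 * d)) := by gcongr
      _ = 2 ^ (60 + 10 * d + (6 * d + 15 * d)) := by rw [pow_add, pow_add, pow_add]
      _ ≤ 2 ^ (d * 60) := pow_le_pow_right₀ (by norm_num) (by omega)
      _ = _ := by rw [pow_mul]
  have h6 := le_of_pow_le_pow_left₀ (by norm_num) (by positivity) h5
  exact_mod_cast h6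

open Finset in
/-- At least half of all databases have all their points at distance more than `d / 20` from `x`. -/
theorem card_databases_le_two_mul_card_far {n d : ℕ} (hd : 3 ≤ d) (hn : n ^ 6 ≤ 2 ^ d)
    (x : Fin d → Bool) :
    Fintype.card (Fin n → Fin d → Bool) ≤
      2 * #{y : Fin n → Fin d → Bool | ∀ j, d < 20 * hammingDist x (y j)} := by
  have hball := two_mul_card_ball_le hd hn x
  set S : Finset (Fin d → Bool) := {z | 20 * hammingDist x z ≤ d} with hS
  have h1 : ({y : Fin n → Fin d → Bool | ∀ j, d < 20 * hammingDist x (y j)} : Finset _) =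
      Fintype.piFinset fun _ => Sᶜ := by
    ext y; simp [hS]
  have hc : Fintype.card (Fin d → Bool) = 2 ^ d := by simp
  rw [h1, Fintype.card_piFinset_const, card_compl, hc, Fintype.card_fun, hc, Fintype.card_fin]
  have hle : #S ≤ 2 ^ d := hc ▸ card_le_univ S
  have hpos : (0 : ℝ) < 2 ^ d := by positivity
  have hball' : 2 * (n : ℝ) * #S ≤ 2 ^ d := by exact_mod_cast hball
  have hle' : (#S : ℝ) ≤ 2 ^ d := by exact_mod_cast hle
  have hb := one_add_mul_le_pow (a := -((#S : ℝ) / 2 ^ d)) (by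
    have : (#S : ℝ) / 2 ^ d ≤ 1 := (div_le_one hpos).2 hle'
    linarith) n
  have h2 : (n : ℝ) * (#S / 2 ^ d) ≤ 1 / 2 := by
    rw [← mul_div_assoc, div_le_iff₀ hpos]; linarith
  have h3 : (1 : ℝ) ≤ 2 * (1 + -((#S : ℝ) / 2 ^ d)) ^ n := by linarith
  have h4 : ((2 : ℝ) ^ d) ^ n ≤ 2 * (2 ^ d - #S) ^ n := by
    calc ((2 : ℝ) ^ d) ^ n = (2 ^ d) ^ n * 1 := by ring
      _ ≤ (2 ^ d) ^ n * (2 * (1 + -((#S : ℝ) / 2 ^ d)) ^ n) := by gcongr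
      _ = 2 * (2 ^ d * (1 + -((#S : ℝ) / 2 ^ d))) ^ n := by rw [mul_pow]; ring
      _ = _ := by congr 2; field_simp; ring
  have h5 : (((2 ^ d - #S : ℕ) : ℝ)) = 2 ^ d - #S := by push_cast [Nat.cast_sub hle]; ring
  rw [← h5] at h4
  exact_mod_cast h4

/-! ### Cell sampling -/

open Finset in
/-- Cell sampling: some set `R` of `m` cells contains `P a` for a fraction of the `a ∈ G` that is
at least the probability `C(m, t) / C(s, t)` that a random `R` contains a fixed set of `t` cells. -/
theorem exists_powersetCard_card_filter_subset_ge {α : Type*} {s t m : ℕ} (G : Finset α)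
    (P : α → Finset (Fin s)) (hP : ∀ a ∈ G, #(P a) = t) (htm : t ≤ m) (hms : m ≤ s) :
    ∃ R : Finset (Fin s), #R = m ∧
      (m.choose t / s.choose t : ℝ) * #G ≤ #{a ∈ G | P a ⊆ R} := by
  have hdc : ∑ R ∈ powersetCard m (univ : Finset (Fin s)), #{a ∈ G | P a ⊆ R} =
      #G * (s - t).choose (m - t) := by
    calc _ = ∑ a ∈ G, #((powersetCard m univ).filter (P a ⊆ ·)) := by
          simp only [card_filter]
          exact sum_comm
      _ = ∑ a ∈ G, (s - t).choose (m - t) := sum_congr rfl fun a ha => by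
          rw [card_filter_powersetCard_subset _ _ _ (subset_univ _) ((hP a ha).trans_le htm),
            hP a ha, card_univ, Fintype.card_fin]
      _ = _ := by rw [sum_const, smul_eq_mul]
  have hne : (powersetCard m (univ : Finset (Fin s))).Nonempty :=
    powersetCard_nonempty.2 (by simpa using hms)
  have hst : (0 : ℝ) < s.choose t := by exact_mod_cast Nat.choose_pos (htm.trans hms)
  obtain ⟨R, hR, hle⟩ := exists_le_of_sum_le (s := powersetCard m (univ : Finset (Fin s)))
    (f := fun _ => (m.choose t / s.choose t : ℝ) * #G)
    (g := fun R => (#{a ∈ G | P a ⊆ R} : ℝ)) hne (by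
      rw [sum_const, card_powersetCard, card_univ, Fintype.card_fin, ← Nat.cast_sum, hdc,
        nsmul_eq_mul]
      have h := congrArg (Nat.cast : ℕ → ℝ) (Nat.choose_mul (n := s) htm)
      push_cast at h ⊢
      apply le_of_eq
      field_simp
      linear_combination (#G : ℝ) * h)
  exact ⟨R, (mem_powersetCard.1 hR).2, hle⟩

open Finset in
/-- Averaging: if a set of pairs has density at least `2κ`, then at least a fraction `κ` of the
columns have density at least `κ`. -/
theorem mul_card_le_card_dense_columns {X Y : Type*} [Fintype X] [Fintype Y] [Nonempty X]
    [DecidableEq Y] (G : Finset (X × Y)) {κ : ℝ}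
    (hG : 2 * κ * (Fintype.card X * Fintype.card Y) ≤ #G) :
    κ * Fintype.card Y ≤
      #{y : Y | κ * Fintype.card X ≤ #{p ∈ G | p.2 = y}} := by
  classical
  set Y₁ : Finset Y := {y : Y | κ * Fintype.card X ≤ #{p ∈ G | p.2 = y}} with hY₁
  have hX : (0 : ℝ) < Fintype.card X := by exact_mod_cast Fintype.card_pos
  have hcol : ∀ y, #{p ∈ G | p.2 = y} ≤ Fintype.card X := fun y => by
    rw [← card_univ]
    refine card_le_card_of_injOn Prod.fst (fun _ _ => mem_coe.2 (mem_univ _)) ?_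
    rintro ⟨x, y₁⟩ h₁ ⟨x', y₂⟩ h₂ rfl
    simp only [coe_filter, Set.mem_ofPred_eq] at h₁ h₂
    rw [h₁.2, h₂.2]
  have hsum : (#G : ℝ) = ∑ y : Y, (#{p ∈ G | p.2 = y} : ℝ) := by
    exact_mod_cast card_eq_sum_card_fiberwise (f := Prod.snd) (t := univ) (by simp)
  have hκ : (#G : ℝ) ≤ ∑ y : Y, ((if y ∈ Y₁ then (Fintype.card X : ℝ) else 0) +
      if y ∈ Y₁ then 0 else κ * Fintype.card X) := by
    rw [hsum]
    refine sum_le_sum fun y _ => ?_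
    by_cases hy : y ∈ Y₁
    · simpa [hy] using hcol y
    · simp only [hy, if_false, zero_add]
      simp only [hY₁, mem_filter, mem_univ, true_and, not_le] at hy
      exact hy.le
  by_cases hk : κ < 0
  · exact (mul_nonpos_of_nonpos_of_nonneg hk.le (by positivity)).trans (by positivity)
  push Not at hk
  have hκ' : (#G : ℝ) ≤ #Y₁ * Fintype.card X + Fintype.card Y * (κ * Fintype.card X) := by
    refine hκ.trans ?_
    rw [sum_add_distrib]
    refine add_le_add (by simp) ?_
    rw [← card_univ, ← nsmul_eq_mul]
    refine sum_le_card_nsmul _ _ _ fun y _ => ?_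
    split_ifs
    · positivity
    · exact le_rfl
  have h : κ * Fintype.card Y * Fintype.card X ≤ #Y₁ * Fintype.card X := by linarith
  exact le_of_mul_le_mul_right h hX

open Finset in
/-- If at least half of all pairs have answer `z`, then certificates give a large rectangle
`A × B` on which `z` is always acceptable: `A` consists of queries whose certificate for a
fixed database of `B` lies in a sampled set `R` of `m` cells, and all databases in `B` have the
same contents of the cells in `R`. The factor `2 ^ (m * w)` counts these contents. -/
theorem HasCertificates.exists_rectangle {X Y Z : Type*} [Fintype X] [Fintype Y] [Nonempty X]
    [Nonempty Y] {f : DSProblem X Y Z} {s w t m : ℕ} (hf : HasCertificates f s w t) {z : Z}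
    {G : Finset (X × Y)} (hGz : ∀ p ∈ G, f p.1 p.2 = some z)
    (hG : Fintype.card X * Fintype.card Y ≤ 2 * #G) (htm : t ≤ m) (hms : m ≤ s) :
    ∃ (A : Finset X) (B : Finset Y),
      (∀ x ∈ A, ∀ y ∈ B, f x y = some z ∨ f x y = none) ∧
      (m.choose t / s.choose t / 4 : ℝ) * Fintype.card X ≤ #A ∧
      (m.choose t / s.choose t / 4 : ℝ) * Fintype.card Y ≤ 2 ^ (m * w) * #B := by
  classical
  obtain ⟨T, hT⟩ := hf
  have hP : ∀ p : X × Y, ∃ P : Finset (Fin s), p ∈ G → #P = t ∧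
      ∀ y', (∀ i ∈ P, T y' i = T p.2 i) → f p.1 y' = some z ∨ f p.1 y' = none := fun p => by
    by_cases hp : p ∈ G
    · obtain ⟨P, hP⟩ := hT p.1 p.2 z (hGz p hp)
      exact ⟨P, fun _ => hP⟩
    · exact ⟨∅, fun h => absurd h hp⟩
  choose P hP using hP
  obtain ⟨R, hRm, hR⟩ :=
    exists_powersetCard_card_filter_subset_ge G P (fun p hp => (hP p hp).1) htm hms
  set ρ : ℝ := m.choose t / s.choose t with hρ
  have hρ0 : 0 < ρ := by
    have h₁ := Nat.choose_pos htm
    have h₂ := Nat.choose_pos (htm.trans hms)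
    positivity
  have hY : (0 : ℝ) < Fintype.card Y := by exact_mod_cast Fintype.card_pos
  have hGR : 2 * (ρ / 4) * (Fintype.card X * Fintype.card Y) ≤ (#{p ∈ G | P p ⊆ R} : ℝ) := by
    have hG' : (Fintype.card X * Fintype.card Y : ℝ) ≤ 2 * #G := by exact_mod_cast hG
    nlinarith
  have hY₁ := mul_card_le_card_dense_columns {p ∈ G | P p ⊆ R} hGR
  set Y₁ : Finset Y :=
    {y : Y | ρ / 4 * Fintype.card X ≤ #{p ∈ {p ∈ G | P p ⊆ R} | p.2 = y}} with hY₁def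
  have hY₁0 : (0 : ℝ) < #Y₁ := lt_of_lt_of_le (by positivity) hY₁
  -- Restrict to the most frequent contents of the cells in `R`.
  let g : Y → (R → Fin w → Bool) := fun y i => T y i
  obtain ⟨b, -, hb⟩ := exists_le_card_fiber_of_nsmul_le_card_of_maps_to (s := Y₁) (t := univ)
    (f := g) (b := (#Y₁ : ℝ) / 2 ^ (m * w)) (fun _ _ => mem_univ _) univ_nonempty (by
      rw [card_univ, nsmul_eq_mul]
      simp only [Fintype.card_pi, Fintype.card_bool, prod_const, card_univ, Fintype.card_fin,
        Fintype.card_coe, hRm]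
      rw [← pow_mul, mul_comm w m]
      push_cast
      exact (mul_div_cancel₀ _ (by positivity)).le)
  have hb0 : (0 : ℝ) < #{y ∈ Y₁ | g y = b} := lt_of_lt_of_le (by positivity) hb
  obtain ⟨y₀, hy₀⟩ := card_pos.1 (by exact_mod_cast hb0)
  obtain ⟨hy₀Y, hy₀b⟩ := mem_filter.1 hy₀
  refine ⟨({p ∈ {p ∈ G | P p ⊆ R} | p.2 = y₀}).image Prod.fst, {y ∈ Y₁ | g y = b}, ?_, ?_, ?_⟩
  · intro x hx y hy
    obtain ⟨⟨x', y'⟩, hp, rfl⟩ := mem_image.1 hx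
    simp only [mem_filter] at hp
    obtain ⟨⟨hpG, hpR⟩, rfl⟩ := hp
    refine (hP _ hpG).2 y fun i hi => ?_
    exact congrFun ((mem_filter.1 hy).2.trans hy₀b.symm) ⟨i, hpR hi⟩
  · rw [card_image_of_injOn]
    · exact (mem_filter.1 hy₀Y).2
    · rintro ⟨x, y₁⟩ h₁ ⟨x', y₂⟩ h₂ rfl
      simp only [coe_filter, Set.mem_ofPred_eq] at h₁ h₂
      rw [h₁.2, h₂.2]
  · rw [div_le_iff₀ (by positivity)] at hb
    linarith

theorem pow_le_choose_div_choose {s m t : ℕ} (htm : t ≤ m) (hms : m ≤ s) :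
    (((m + 1 - t : ℕ) : ℝ) / s) ^ t ≤ m.choose t / s.choose t := by
  have hst : (0 : ℝ) < s.choose t := by exact_mod_cast Nat.choose_pos (htm.trans hms)
  rcases Nat.eq_zero_or_pos t with rfl | ht
  · simp
  have hs : (0 : ℝ) < s := by exact_mod_cast (ht.trans_le (htm.trans hms))
  rw [div_pow, div_le_div_iff₀ (by positivity) hst]
  have h1 : (m + 1 - t) ^ t ≤ t.factorial * m.choose t :=
    (Nat.pow_sub_le_descFactorial m t).trans_eq (Nat.descFactorial_eq_factorial_mul_choose m t)
  have h2 : t.factorial * s.choose t ≤ s ^ t :=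
    (Nat.descFactorial_eq_factorial_mul_choose s t).symm.trans_le (Nat.descFactorial_le_pow s t)
  have h3 : t.factorial * ((m + 1 - t) ^ t * s.choose t) ≤ t.factorial * (m.choose t * s ^ t) := by
    calc t.factorial * ((m + 1 - t) ^ t * s.choose t)
        = (m + 1 - t) ^ t * (t.factorial * s.choose t) := by ring
      _ ≤ (t.factorial * m.choose t) * s ^ t := Nat.mul_le_mul h1 h2
      _ = _ := by ring
  exact_mod_cast Nat.le_of_mul_le_mul_left h3 (Nat.factorial_pos t)

/-! ### Certificates for approximate near neighbor -/

theorem HasCertificates.pos_of_ANN {n d lam s w t : ℕ} {γ : ℝ} (hn : 1 ≤ n)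
    (hγ : 1 ≤ γ) (hlam : γ * lam < d) (h : HasCertificates (ANN n d lam γ) s w t) : 0 < t := by
  rw [Nat.pos_iff_ne_zero]
  rintro rfl
  -- With no cells read the answer could not depend on the database.
  obtain ⟨T, hT⟩ := h
  have hyes : ANN n d lam γ (fun _ => false) (fun _ _ => false) = some true := by
    rw [ANN, if_pos ⟨⟨0, hn⟩, by simp⟩]
  obtain ⟨P, hP, hP'⟩ := hT _ _ _ hyes
  rw [Finset.card_eq_zero] at hP
  subst hP
  have hdist : hammingDist (fun _ : Fin d => false) (fun _ => true) = d := by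
    simp [hammingDist]
  have hno : ANN n d lam γ (fun _ => false) (fun _ _ => true) = some false := by
    have hlt : lam < d := by
      have h0 : (0 : ℝ) ≤ lam := by positivity
      have : (lam : ℝ) < d := by nlinarith
      exact_mod_cast this
    rw [ANN, if_neg, if_pos fun _ => by rw [hdist]; exact hlam]
    rintro ⟨j, hj⟩
    rw [hdist] at hj
    omega
  simpa [hno] using hP' (fun _ _ => true) (by simp)

theorem HasCertificates.le_of_ANN {n d lam s w t : ℕ} {γ : ℝ} (hn : 1 ≤ n)
    (h : HasCertificates (ANN n d lam γ) s w t) : t ≤ s := by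
  obtain ⟨T, hT⟩ := h
  obtain ⟨P, hP, -⟩ := hT (fun _ => false) (fun _ _ => false) true
    (by rw [ANN, if_pos ⟨⟨0, hn⟩, by simp⟩])
  simpa [hP] using P.card_le_univ

/-- If the contents of `m` cells have few bits compared with `n L`, where `L = lam² / d`, then
`m` sampled cells contain a given certificate with probability at most `4 exp (-L / 4)`: all
points of all databases of the rectangle of `HasCertificates.exists_rectangle` are far from all its
queries, which makes the rectangle small. -/
theorem HasCertificates.choose_div_choose_le {n d lam s w t m : ℕ} {γ : ℝ} (hn : 1 ≤ n)
    (hd : 3 ≤ d) (hnd : n ^ 6 ≤ 2 ^ d) (hγ : 1 ≤ γ) (hlam : 20 * (γ * lam) ≤ d)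
    (h : HasCertificates (ANN n d lam γ) s w t) (htm : t ≤ m) (hms : m ≤ s)
    (hmw : (m * w : ℝ) ≤ n * ((lam : ℝ) ^ 2 / d) / 2) :
    (m.choose t / s.choose t : ℝ) ≤ 4 * Real.exp (-((lam : ℝ) ^ 2 / d / 4)) := by
  classical
  have hnear : ∀ k : ℕ, d < 20 * k → γ * lam < k := fun k hk => by
    have : (d : ℝ) < 20 * k := by exact_mod_cast hk
    linarith
  -- On `G` all distances exceed `d / 20 ≥ γ * lam`, so the answer is `no`.
  let G : Finset ((Fin d → Bool) × (Fin n → Fin d → Bool)) :=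
    {p | ∀ j, d < 20 * hammingDist p.1 (p.2 j)}
  have hGz : ∀ p ∈ G, ANN n d lam γ p.1 p.2 = some false := fun p hp => by
    have hp' := (Finset.mem_filter.1 hp).2
    rw [ANN, if_neg, if_pos fun j => hnear _ (hp' j)]
    rintro ⟨j, hj⟩
    have h1 := hnear _ (hp' j)
    have h2 : (hammingDist p.1 (p.2 j) : ℝ) ≤ lam := by exact_mod_cast hj
    nlinarith [(Nat.cast_nonneg lam : (0 : ℝ) ≤ lam)]
  have hG : Fintype.card (Fin d → Bool) * Fintype.card (Fin n → Fin d → Bool) ≤ 2 * G.card := by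
    have hGc : G.card = ∑ x : Fin d → Bool,
        (Finset.univ.filter fun y : Fin n → Fin d → Bool =>
          ∀ j, d < 20 * hammingDist x (y j)).card := by
      simp only [G, Finset.card_filter, Fintype.sum_prod_type]
    rw [hGc, Finset.mul_sum, ← Finset.card_univ, ← smul_eq_mul]
    exact Finset.card_nsmul_le_sum _ _ _ fun x _ => card_databases_le_two_mul_card_far hd hnd x
  obtain ⟨A, B, hAB, hA, hB⟩ := h.exists_rectangle hGz hG htm hms
  let F : Finset (Fin d → Bool) := {z | ∀ x ∈ A, lam ≤ hammingDist x z}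
  have hBF : B.card ≤ F.card ^ n := by
    have : B ⊆ Fintype.piFinset fun _ => F := fun y hy => by
      rw [Fintype.mem_piFinset]
      refine fun j => Finset.mem_filter.2 ⟨Finset.mem_univ _, fun x hx => ?_⟩
      by_contra hlt
      have hyes : ANN n d lam γ x y = some true := by
        rw [ANN, if_pos ⟨j, by omega⟩]
      simpa [hyes] using hAB x hx y hy
    simpa using Finset.card_le_card this
  have hiso : (A.card : ℝ) * F.card ≤ 4 ^ d * Real.exp (-((lam : ℝ) ^ 2 / d)) :=
    card_mul_card_le_exp (by omega) fun x hx z hz => (Finset.mem_filter.1 hz).2 x hx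
  set ρ : ℝ := m.choose t / s.choose t with hρ
  set L : ℝ := (lam : ℝ) ^ 2 / d with hL
  have hρ0 : 0 ≤ ρ := by positivity
  have hρ1 : ρ ≤ 1 := div_le_one_of_le₀
    (by exact_mod_cast Nat.choose_le_choose t hms) (by positivity)
  simp only [Fintype.card_fun, Fintype.card_bool, Fintype.card_fin] at hA hB
  push_cast at hA hB
  have hBF' : (B.card : ℝ) ≤ (F.card : ℝ) ^ n := by exact_mod_cast hBF
  have h1 : (ρ / 4) ^ (n + 1) ≤ 2 ^ (m * w) * Real.exp (-L) ^ n := by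
    have h2 : (ρ / 4) ^ (n + 1) * (4 ^ d) ^ n ≤
        2 ^ (m * w) * Real.exp (-L) ^ n * (4 ^ d) ^ n := by
      calc (ρ / 4) ^ (n + 1) * (4 ^ d) ^ n
          = (ρ / 4 * 2 ^ d) ^ n * (ρ / 4 * (2 ^ d) ^ n) := by
            rw [show (4 : ℝ) = 2 * 2 by norm_num, mul_pow 2 2 d, mul_pow, mul_pow, pow_succ]
            ring
        _ ≤ (A.card : ℝ) ^ n * (2 ^ (m * w) * (F.card : ℝ) ^ n) := by
            refine mul_le_mul (pow_le_pow_left₀ (by positivity) hA n) (hB.trans ?_)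
              (by positivity) (by positivity)
            gcongr
        _ = 2 ^ (m * w) * (A.card * F.card : ℝ) ^ n := by rw [mul_pow]; ring
        _ ≤ 2 ^ (m * w) * (4 ^ d * Real.exp (-L)) ^ n := by gcongr
        _ = _ := by rw [mul_pow]; ring
    exact le_of_mul_le_mul_right h2 (by positivity)
  have h3 : (2 : ℝ) ^ (m * w) ≤ Real.exp (n * L / 2) := by
    calc (2 : ℝ) ^ (m * w) ≤ Real.exp 1 ^ (m * w) := by
          have := Real.exp_one_gt_d9
          exact pow_le_pow_left₀ (by norm_num) (by linarith) _
      _ = Real.exp (m * w) := by rw [← Real.exp_nat_mul]; push_cast; rw [mul_one]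
      _ ≤ _ := Real.exp_le_exp.2 hmw
  -- As `n + 1 ≤ 2 n`, taking `2 n`-th roots removes the dependence on `n`.
  have h4 : (ρ / 4) ^ (2 * n) ≤ Real.exp (-(L / 4)) ^ (2 * n) := by
    calc (ρ / 4) ^ (2 * n) ≤ (ρ / 4) ^ (n + 1) :=
          pow_le_pow_of_le_one (by positivity) (by linarith) (by omega)
      _ ≤ Real.exp (n * L / 2) * Real.exp (-L) ^ n :=
          h1.trans (mul_le_mul_of_nonneg_right h3 (by positivity))
      _ = _ := by
          rw [← Real.exp_nat_mul, ← Real.exp_nat_mul, ← Real.exp_add]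
          push_cast
          ring_nf
  have h5 := le_of_pow_le_pow_left₀ (by omega) (by positivity) h4
  linarith

theorem four_mul_exp_neg_le {L : ℝ} (hL : 12 ≤ L) :
    4 * Real.exp (-(L / 4)) ≤ Real.exp (-(L / 8)) := by
  have h1 : (4 : ℝ) ≤ Real.exp (L / 8) := by
    have h3 : Real.exp (3 / 2) ^ 2 = Real.exp 1 ^ 3 := by
      rw [← Real.exp_nat_mul, ← Real.exp_nat_mul]; norm_num
    have h4 : (2.7 : ℝ) ^ 3 ≤ Real.exp 1 ^ 3 :=
      pow_le_pow_left₀ (by norm_num) (by have := Real.exp_one_gt_d9; linarith) 3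
    have h5 : (4 : ℝ) ^ 2 ≤ Real.exp (3 / 2) ^ 2 := by
      rw [h3]; refine le_trans ?_ h4; norm_num
    exact (le_of_pow_le_pow_left₀ (by norm_num) (by positivity) h5).trans
      (Real.exp_le_exp.2 (by linarith))
  calc 4 * Real.exp (-(L / 4)) ≤ Real.exp (L / 8) * Real.exp (-(L / 4)) := by gcongr
    _ = Real.exp (-(L / 8)) := by rw [← Real.exp_add]; ring_nf

/-- The trade-off in terms of `L = lam² / d`, from sampling about `n L / (2 w)` cells. The first
alternative is the case in which a certificate is too large to fit comfortably into the sample. -/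
theorem HasCertificates.le_or_le_log_of_ANN {n d lam s w t : ℕ} {γ L : ℝ} (hn : 1 ≤ n) (hd : 3 ≤ d)
    (hnd : n ^ 6 ≤ 2 ^ d) (hγ : 1 ≤ γ) (hlam : 20 * (γ * lam) ≤ d) (hw : w ≤ n)
    (hL : L = (lam : ℝ) ^ 2 / d) (hL12 : 12 ≤ L) (h : HasCertificates (ANN n d lam γ) s w t) :
    L / 8 ≤ t ∨ 0 < s * w ∧ L / 8 ≤ t * Real.log (8 * (s * w) / (n * L)) := by
  have hn0 : (0 : ℝ) < n := by exact_mod_cast hn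
  have hwn : (w : ℝ) ≤ n := by exact_mod_cast hw
  -- The factor `4` is absorbed since `L` is large.
  have hstep : ∀ m, t ≤ m → m ≤ s → (m * w : ℝ) ≤ n * L / 2 →
      (m.choose t / s.choose t : ℝ) ≤ Real.exp (-(L / 8)) := fun m htm hms hmw => by
    refine le_trans ?_ (four_mul_exp_neg_le hL12)
    rw [hL] at hmw ⊢
    exact h.choose_div_choose_le hn hd hnd hγ hlam htm hms hmw
  clear hL
  -- Otherwise the whole table could be sampled, and would contain every certificate.
  have hsw : n * L / 2 < (s * w : ℝ) := by
    by_contra hle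
    push Not at hle
    have hts := h.le_of_ANN hn
    have h1 := hstep s hts le_rfl hle
    rw [div_self (by exact_mod_cast (Nat.choose_pos hts).ne')] at h1
    have h2 : Real.exp (-(L / 8)) < 1 := by rw [Real.exp_lt_one_iff]; linarith
    linarith
  have hsw0 : 0 < s * w := by
    have h1 : 0 ≤ n * L / 2 := by positivity
    exact_mod_cast h1.trans_lt hsw
  have hw0 : (0 : ℝ) < w := by exact_mod_cast Nat.pos_of_mul_pos_left hsw0
  have hs0 : (0 : ℝ) < s := by exact_mod_cast Nat.pos_of_mul_pos_right hsw0
  -- The largest number of cells allowed by `hstep`. As `w ≤ n`, rounding down at most halves it.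
  set m := ⌊n * L / (2 * w)⌋₊ with hm
  have hmle : (m : ℝ) ≤ n * L / (2 * w) := Nat.floor_le (by positivity)
  have hmw : (m * w : ℝ) ≤ n * L / 2 := by
    rw [le_div_iff₀ (by positivity)] at hmle; linarith
  have hms : m ≤ s := by
    have h1 : (m * w : ℝ) ≤ s * w := hmw.trans hsw.le
    exact_mod_cast le_of_mul_le_mul_right h1 hw0
  have hmge : n * L / (4 * w) ≤ m := by
    have h1 : n * L / (2 * w) < m + 1 := Nat.lt_floor_add_one _
    have h2 : 2 ≤ n * L / (2 * w) := by
      rw [le_div_iff₀ (by positivity)]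
      nlinarith
    have h3 : n * L / (4 * w) = n * L / (2 * w) / 2 := by field_simp; norm_num
    linarith
  have hm0 : (0 : ℝ) < m := lt_of_lt_of_le (by positivity) hmge
  by_cases h2t : m ≤ 2 * t
  · left
    have h1 : (m : ℝ) ≤ 2 * t := by exact_mod_cast h2t
    have h2 : L / 4 ≤ n * L / (4 * w) := by
      rw [div_le_div_iff₀ (by norm_num) (by positivity)]
      nlinarith
    linarith
  refine Or.inr ⟨hsw0, ?_⟩
  push Not at h2t
  have htm : t ≤ m := by omega
  have hpow : ((m : ℝ) / (2 * s)) ^ t ≤ Real.exp (-(L / 8)) := by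
    refine le_trans ?_ ((pow_le_choose_div_choose htm hms).trans (hstep m htm hms hmw))
    refine pow_le_pow_left₀ (by positivity) ?_ t
    have h1 : (m : ℝ) ≤ (m + 1 - t : ℕ) * 2 := by
      exact_mod_cast (by omega : m ≤ (m + 1 - t) * 2)
    rw [div_le_div_iff₀ (by positivity) hs0]
    calc (m : ℝ) * s ≤ ((m + 1 - t : ℕ) * 2) * s := by gcongr
      _ = _ := by ring
  have h1 := Real.log_le_log (by positivity) hpow
  rw [Real.log_exp, Real.log_pow, ← inv_div, Real.log_inv] at h1
  have h2 : Real.log (2 * s / m) ≤ Real.log (8 * (s * w) / (n * L)) := by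
    refine Real.log_le_log (by positivity) ?_
    calc 2 * (s : ℝ) / m ≤ 2 * s / (n * L / (4 * w)) := by gcongr
      _ = _ := by field_simp; norm_num
  have h3 : (t : ℝ) * Real.log (2 * s / m) ≤ t * Real.log (8 * (s * w) / (n * L)) := by gcongr
  linarith

theorem HasCertificates.div_pow_three_div_logb_le {n d s w t : ℕ} {γ : ℝ} (hn : 1 ≤ n)
    (hγ : 1 ≤ γ) (hd : (1 + 5 * γ) * Real.logb 2 n ≤ d) (hw : w ≤ n)
    (h : HasCertificates (ANN n d ⌊(d : ℝ) / (20 * γ)⌋₊ γ) s w t) :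
    1 / 192000 * (((d : ℝ) / γ ^ 3) /
      Real.logb 2 (max 2 (((s : ℝ) * w * γ ^ 3) / (n * d)))) ≤ t := by
  rcases Nat.eq_zero_or_pos d with rfl | hd0
  · simp
  set M : ℝ := max 2 (((s : ℝ) * w * γ ^ 3) / (n * d)) with hM
  have hM2 : 2 ≤ M := le_max_left _ _
  have hlog1 : 1 ≤ Real.logb 2 M := by
    rw [Real.le_logb_iff_rpow_le (by norm_num) (by linarith)]; simpa using hM2
  have hd0' : (0 : ℝ) < d := by exact_mod_cast hd0
  have hn0 : (0 : ℝ) < n := by exact_mod_cast hn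
  have hγ0 : 0 < γ := by linarith
  rw [← mul_div_assoc, div_le_iff₀ (by linarith)]
  have hγ23 : γ ^ 2 ≤ γ ^ 3 := pow_le_pow_right₀ hγ (by norm_num)
  have hd23 : (d : ℝ) / γ ^ 3 ≤ d / γ ^ 2 := by gcongr
  set lam := ⌊(d : ℝ) / (20 * γ)⌋₊ with hlam
  have hlamle : (lam : ℝ) ≤ d / (20 * γ) := Nat.floor_le (by positivity)
  have hlamd : 20 * (γ * lam) ≤ d := by
    rw [le_div_iff₀ (by positivity)] at hlamle; linarith
  have ht : (1 : ℝ) ≤ t := by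
    exact_mod_cast h.pos_of_ANN hn hγ (by linarith)
  -- For bounded `d / γ ^ 2` the bound says no more than `0 < t`.
  by_cases hsmall : (d : ℝ) / γ ^ 2 ≤ 20000
  · nlinarith
  push Not at hsmall
  have hsmall' : 20000 * γ ^ 2 < d := by rwa [lt_div_iff₀ (by positivity)] at hsmall
  have hd3 : 3 ≤ d := by
    have : (3 : ℝ) ≤ d := by nlinarith
    exact_mod_cast this
  have hnd : n ^ 6 ≤ 2 ^ d := by
    have h1 : 0 ≤ Real.logb 2 n := Real.logb_nonneg (by norm_num) (by exact_mod_cast hn)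
    have h2 : Real.logb 2 ((n : ℝ) ^ 6) ≤ d := by
      rw [Real.logb_pow]; push_cast; nlinarith
    rw [Real.logb_le_iff_le_rpow (by norm_num) (by positivity), Real.rpow_natCast] at h2
    exact_mod_cast h2
  obtain ⟨L, hL⟩ : ∃ L : ℝ, L = (lam : ℝ) ^ 2 / d := ⟨_, rfl⟩
  have hLd : (d : ℝ) / γ ^ 2 / 1600 ≤ L := by
    have h1 : (d : ℝ) / (20 * γ) < lam + 1 := Nat.lt_floor_add_one _
    have h2 : 2 ≤ (d : ℝ) / (20 * γ) := by
      rw [le_div_iff₀ (by positivity)]; nlinarith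
    have h3 : (d : ℝ) / (20 * γ) / 2 ≤ lam := by linarith
    have h4 : ((d : ℝ) / (20 * γ) / 2) ^ 2 ≤ (lam : ℝ) ^ 2 :=
      pow_le_pow_left₀ (by positivity) h3 2
    rw [hL, le_div_iff₀ hd0']
    refine le_trans (le_of_eq ?_) h4
    field_simp
    norm_num
  have hL12 : 12 ≤ L := by linarith
  rcases h.le_or_le_log_of_ANN hn hd3 hnd hγ hlamd hw hL hL12 with hLt | ⟨hsw0, hLt⟩
  · have : (t : ℝ) * 1 ≤ t * Real.logb 2 M := by gcongr
    linarith
  have hsw0' : (0 : ℝ) < s * w := by exact_mod_cast hsw0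
  -- The constant `12800` is turned into a power of `M ≥ 2`, hence a constant factor outside
  -- the logarithm.
  have hM15 : 8 * (s * w) / (n * L) ≤ M ^ 15 := by
    have h5 : (s * w * γ ^ 3 / (n * d) : ℝ) ≤ M := le_max_right _ _
    have h6 : (12800 : ℝ) ≤ M ^ 14 :=
      le_trans (by norm_num) (pow_le_pow_left₀ (by norm_num) hM2 14)
    have h7 : (d : ℝ) / γ ^ 3 / 1600 ≤ L := by linarith
    calc 8 * (s * w) / (n * L) ≤ 8 * (s * w) / (n * ((d : ℝ) / γ ^ 3 / 1600)) := by gcongr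
      _ = 12800 * (s * w * γ ^ 3 / (n * d) : ℝ) := by field_simp; ring
      _ ≤ M ^ 14 * M := by gcongr
      _ = M ^ 15 := by ring
  have hlogM : Real.log (8 * (s * w) / (n * L)) ≤ 15 * Real.logb 2 M := by
    have h1 := Real.log_le_log (by positivity) hM15
    rw [Real.log_pow] at h1
    have h2 : Real.log M = Real.logb 2 M * Real.log 2 := by
      rw [Real.logb, div_mul_cancel₀]; exact (Real.log_pos (by norm_num)).ne'
    have h3 : Real.log 2 ≤ 1 := by have := Real.log_two_lt_d9; linarith
    have h4 : Real.logb 2 M * Real.log 2 ≤ Real.logb 2 M * 1 := by gcongr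
    push_cast at h1
    linarith
  have h8 := mul_le_mul_of_nonneg_left hlogM (by linarith : (0 : ℝ) ≤ t)
  linarith

theorem mainTheorem3 :
    ∃ lam : ℕ → ℕ → ℝ → ℕ,
      (∃ c : ℝ, 0 < c ∧ ∀ (n d : ℕ) (γ : ℝ), 1 ≤ n → 1 ≤ γ →
        (1 + 5 * γ) * Real.logb 2 (n : ℝ) ≤ (d : ℝ) →
        ∀ s w t : ℕ, w ≤ n → HasCertificates (ANN n d (lam n d γ) γ) s w t →
          c * (((d : ℝ) / γ ^ 3) /
            Real.logb 2 (max 2 (((s : ℝ) * (w : ℝ) * γ ^ 3) / ((n : ℝ) * (d : ℝ))))) ≤ (t : ℝ)) ∧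
      (∀ γ K : ℝ, 1 ≤ γ → 0 < K → ∃ c : ℝ, 0 < c ∧ ∀ n d : ℕ, 1 ≤ n →
        (1 + 5 * γ) * Real.logb 2 (n : ℝ) ≤ (d : ℝ) →
        ∀ s w t : ℕ, w ≤ n → (s : ℝ) * (w : ℝ) ≤ K * ((n : ℝ) * (d : ℝ)) →
          HasCertificates (ANN n d (lam n d γ) γ) s w t → c * (d : ℝ) ≤ (t : ℝ)) := by
  -- The second part is the first with `s w / (n d)` replaced by its upper bound `K`.
  refine ⟨fun _ d γ => ⌊(d : ℝ) / (20 * γ)⌋₊, ⟨1 / 192000, by norm_num, ?_⟩, ?_⟩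
  · intro n d γ hn hγ hd s w t hw h
    exact h.div_pow_three_div_logb_le hn hγ hd hw
  · intro γ K hγ hK
    have hγ0 : 0 < γ := by linarith
    have hpos : 0 < Real.logb 2 (max 2 (K * γ ^ 3)) :=
      Real.logb_pos (by norm_num) (lt_of_lt_of_le (by norm_num) (le_max_left _ _))
    refine ⟨1 / 192000 / γ ^ 3 / Real.logb 2 (max 2 (K * γ ^ 3)), by positivity, ?_⟩
    intro n d hn hd s w t hw hsw h
    refine le_trans ?_ (h.div_pow_three_div_logb_le hn hγ hd hw)
    have hle : (s : ℝ) * w * γ ^ 3 / (n * d) ≤ K * γ ^ 3 := by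
      refine div_le_of_le_mul₀ (by positivity) (by positivity) ?_
      have := mul_le_mul_of_nonneg_right hsw (by positivity : 0 ≤ γ ^ 3)
      linarith
    have h2 : Real.logb 2 (max 2 ((s : ℝ) * w * γ ^ 3 / (n * d))) ≤
        Real.logb 2 (max 2 (K * γ ^ 3)) :=
      Real.logb_le_logb_of_le (by norm_num) (lt_of_lt_of_le (by norm_num) (le_max_left _ _))
        (max_le_max le_rfl hle)
    have h3 : 0 < Real.logb 2 (max 2 ((s : ℝ) * w * γ ^ 3 / (n * d))) :=
      Real.logb_pos (by norm_num) (lt_of_lt_of_le (by norm_num) (le_max_left _ _))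
    calc 1 / 192000 / γ ^ 3 / Real.logb 2 (max 2 (K * γ ^ 3)) * d
        = 1 / 192000 * ((d / γ ^ 3) / Real.logb 2 (max 2 (K * γ ^ 3))) := by ring
      _ ≤ _ := by gcongr
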